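/- Let $d\ge 1$ and $D=[0,1]^d\subset\mathbb R^d$. **Conventions.** For $\kappa\in L^1(\mathbb R^d)$ write $\hat\kappa(\omega)=\int_{\mathbb R^d}e^{-i\langle x,\omega\rangle}\kappa(x)\,dx$. For $\alpha>0$ let $l$ be the largest integer strictly less than $\alpha$. The space $C^\alpha(D)$ consists of the $f\in C^l(D)$ (derivatives up to the boundary) with $$\|f\|_{C^\alpha(D)}=\sum_{j=0}^{l}\sup_{x\in D}\|D^jf(x)\|+[f]_\alpha<\infty .$$ If $\alpha\notin\mathbb N$, then $C^\alpha(D)$ is the usual Hölder space: $[f]_\alpha=\sup_{x\ne y}\|D^lf(x)-D^lf(y)\|/\|x-y\|^{\alpha-l}$. If $\alpha\in\mathbb N$, then $C^\alpha(D)$ is the Hölder–Zygmund space: $[f]_\alpha=\sup_{x\neq y}\|D^lf(x)+D^lf(y)-2D^lf(\tfrac{x+y}2)\|/\|x-y\|$. **(1)** Let $k(x,y)=\kappa(x-y)$ be a symmetric positive-definite translation-invariant kernel on $\mathbb R^d$ with $\kappa:\mathbb R^d\to\mathbb R$ continuous and integrable. Suppose that $\hat\kappa$ decays polynomially with rate $s\in\mathbb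 N$, $s>d/2$: there are constants $0<c_1\le c_2$ with $$c_1(1+\|\omega\|_2^2)^{-s}\le\hat\kappa(\omega)\le c_2(1+\|\omega\|_2^2)^{-s}\qquad\text{for all }\omega\in\mathbb R^d .$$ Then the reproducing kernel Hilbert space $\mathcal H_k(D)$ of $k$ on $D$ is continuously embedded into $C^{s-d/2}(D)$: there is a constant $C$ such that every $f\in\mathcal H_k(D)$ belongs to $C^{s-d/2}(D)$ and satisfies $\|f\|_{C^{s-d/2}(D)}\le C\|f\|_{\mathcal H_k(D)}$. **(2)** Let $\nu>0$ and $\ell>0$, and let $$\kappa_{\nu,\ell}(x)=\frac{2^{1-\nu}}{\Gamma(\nu)}\Big(\frac{\sqrt{2\nu}\,\|x\|_2}{\ell}\Big)^{\nu}K_\nu\Big(\frac{\sqrt{2\nu}\,\|x\|_2}{\ell}\Big)\quad(x\ne0),\qquad\kappa_{\nu,\ell}(0)=1,$$ where $K_\nu$ is the modified Bessel function of the second kind. Then the Matérn-$\nu$ kernel $\kappa_{\nu,\ell}(x-y)$ is symmetric and positive definite, $\kappa_{\nu,\ell}$ is continuous and integrable, $\hat\kappa_{\nu,\ell}$ decays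 polynomially with rate $\nu+d/2$ in the sense of (1) (with $\nu+d/2$ in place of $s$), and the RKHS of this kernel on $D$ is continuously embedded into $C^\nu(D)$. -/

import Mathlib

open MeasureTheory
open scoped NNReal ENNReal FourierTransform

universe u

noncomputable section

/-! ### Translation-invariant kernels and the decay of their Fourier transform -/

/-- The Fourier transform `κ̂(ω) = ∫ exp(-i ⟪x, ω⟫) κ(x) dx` in the angular-frequency convention. -/
def angularFourier {d : ℕ} (κ : EuclideanSpace ℝ (Fin d) → ℝ) (ω : EuclideanSpace ℝ (Fin d)) : ℂ :=
  𝓕 (fun x => (κ x : ℂ)) ((2 * Real.pi)⁻¹ • ω)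

theorem angularFourier_eq_integral {d : ℕ} (κ : EuclideanSpace ℝ (Fin d) → ℝ)
    (ω : EuclideanSpace ℝ (Fin d)) :
    angularFourier κ ω = ∫ x, Complex.exp (-(inner ℝ x ω : ℝ) * Complex.I) * (κ x : ℂ) := by
  unfold angularFourier
  rw [Real.fourier_eq']
  refine integral_congr_ae (Filter.Eventually.of_forall fun x => ?_)
  have hπ : (Real.pi : ℝ) ≠ 0 := Real.pi_ne_zero
  have h : -2 * Real.pi * inner ℝ x ((2 * Real.pi)⁻¹ • ω) = -(inner ℝ x ω : ℝ) := by
    rw [real_inner_smul_right]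
    field_simp
  simp only [smul_eq_mul, h]
  push_cast
  rfl

/-- `(x, y) ↦ κ (x - y)` is a continuous (symmetric) positive-definite kernel on `ℝᵈ` with integrable
profile `κ`, whose Fourier transform decays polynomially with rate `s`:
`c₁ (1 + ‖ω‖²)^(-s) ≤ κ̂(ω) ≤ c₂ (1 + ‖ω‖²)^(-s)` for all `ω`.
Positive definiteness is in the usual sense of reproducing kernels: the kernel is symmetric and all
its finite quadratic forms are nonnegative. By symmetry `κ̂` is real-valued. -/
structure IsKernelWithFourierDecay {d : ℕ} (κ : EuclideanSpace ℝ (Fin d) → ℝ) (s : ℝ) : Prop where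
  continuous : Continuous κ
  integrable : Integrable κ
  posDef : (Matrix.of fun x y : EuclideanSpace ℝ (Fin d) => κ (x - y)).PosSemidef
  decay : ∃ c₁ c₂ : ℝ, 0 < c₁ ∧ c₁ ≤ c₂ ∧ ∀ ω : EuclideanSpace ℝ (Fin d),
    c₁ * (1 + ‖ω‖ ^ 2) ^ (-s) ≤ (angularFourier κ ω).re ∧
      (angularFourier κ ω).re ≤ c₂ * (1 + ‖ω‖ ^ 2) ^ (-s)

/-! ### Hölder spaces on the unit cube -/

/-- The domain `[0, 1]ᵈ`. -/
def unitCube (d : ℕ) : Set (EuclideanSpace ℝ (Fin d)) := {x | ∀ i, x i ∈ Set.Icc (0 : ℝ) 1}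

/-- The extension by zero of a function on the unit cube; only its values on the cube matter below,
since all derivatives are taken within the cube. -/
def zeroExtend {d : ℕ} (f : unitCube d → ℝ) : EuclideanSpace ℝ (Fin d) → ℝ :=
  Function.extend Subtype.val f 0

/-- The `j`-th derivative on the cube (one-sided at the boundary). -/
def cubeDeriv {d : ℕ} (j : ℕ) (f : unitCube d → ℝ) (x : EuclideanSpace ℝ (Fin d)) :
    ContinuousMultilinearMap ℝ (fun _ : Fin j => EuclideanSpace ℝ (Fin d)) ℝ :=
  iteratedFDerivWithin ℝ j (zeroExtend f) (unitCube d) x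

/-- For `α > 0`, the largest integer strictly less than `α`. -/
def holderOrder (α : ℝ) : ℕ := ⌈α⌉₊ - 1

/-- The Zygmund seminorm: the least `C` such that
`‖G x + G y - 2 G ((x + y) / 2)‖ ≤ C ‖x - y‖` for all `x`, `y` in the cube (`∞` if there is none). -/
def zygmundSeminorm {d : ℕ} {F : Type*} [NormedAddCommGroup F] [NormedSpace ℝ F]
    (G : EuclideanSpace ℝ (Fin d) → F) : ℝ≥0∞ :=
  ⨅ (C : ℝ≥0) (_ : ∀ x ∈ unitCube d, ∀ y ∈ unitCube d,
    ‖G x + G y - (2 : ℝ) • G (midpoint ℝ x y)‖ ≤ C * ‖x - y‖), (C : ℝ≥0∞)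

open Classical in
/-- The top-order seminorm of `C^α`. With `l` the largest integer strictly less than `α`: the
`(α - l)`-Hölder seminorm of the `l`-th derivative if `α` is not an integer (`0 < α - l < 1`), and the
Zygmund seminorm of the `l`-th derivative if `α` is an integer (`α - l = 1`). -/
def holderSeminorm {d : ℕ} (α : ℝ) (f : unitCube d → ℝ) : ℝ≥0∞ :=
  if α = holderOrder α + 1 then zygmundSeminorm (cubeDeriv (holderOrder α) f)
  else eHolderNorm (α - holderOrder α).toNNReal
    (fun x : unitCube d => cubeDeriv (holderOrder α) f x)

/-- The norm of `C^α([0,1]ᵈ)`: the supremum norms of the derivatives of order at most `l`, plus the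
top-order seminorm. -/
def holderENorm {d : ℕ} (α : ℝ) (f : unitCube d → ℝ) : ℝ≥0∞ :=
  (∑ j ∈ Finset.range (holderOrder α + 1), ⨆ x ∈ unitCube d, ‖cubeDeriv j f x‖ₑ) +
    holderSeminorm α f

/-- Membership in the Hölder space `C^α([0,1]ᵈ)` (Hölder-Zygmund space if `α` is an integer). -/
def MemHolderSpace {d : ℕ} (α : ℝ) (f : unitCube d → ℝ) : Prop :=
  ContDiffOn ℝ (holderOrder α) (zeroExtend f) (unitCube d) ∧ holderENorm α f < ∞

/-! ### Reproducing kernel Hilbert spaces on the unit cube -/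

/-- `H` is the reproducing kernel Hilbert space on `[0,1]ᵈ` of the kernel `(x, y) ↦ κ (x - y)`. -/
def IsRKHSOf {d : ℕ} (H : Type*) [NormedAddCommGroup H] [InnerProductSpace ℝ H] [CompleteSpace H]
    [RKHS ℝ H (unitCube d) ℝ] (κ : EuclideanSpace ℝ (Fin d) → ℝ) : Prop :=
  ∀ x y : unitCube d, RKHS.kernel H x y 1 = κ ((x : EuclideanSpace ℝ (Fin d)) - y)

/-- The RKHS of `(x, y) ↦ κ (x - y)` on `[0,1]ᵈ` is continuously embedded into `C^α([0,1]ᵈ)`. The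
RKHS is unique up to an isometry preserving the functions, so the constant does not depend on the
model `H` of it. -/
def RKHSEmbedsIntoHolder {d : ℕ} (κ : EuclideanSpace ℝ (Fin d) → ℝ) (α : ℝ) : Prop :=
  ∃ C : ℝ≥0, ∀ (H : Type u) [NormedAddCommGroup H] [InnerProductSpace ℝ H] [CompleteSpace H]
    [RKHS ℝ H (unitCube d) ℝ], IsRKHSOf H κ →
    ∀ f : H, MemHolderSpace α (f : unitCube d → ℝ) ∧
      holderENorm α (f : unitCube d → ℝ) ≤ C * ‖f‖ₑ

/-! ### Matérn kernels -/

/-- The modified Bessel function of the second kind,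
`K_ν(z) = ∫₀^∞ exp(-z cosh t) cosh(ν t) dt` for `z > 0`. -/
def besselK (ν z : ℝ) : ℝ :=
  ∫ t in Set.Ioi (0 : ℝ), Real.exp (-z * Real.cosh t) * Real.cosh (ν * t)

open Classical in
/-- The profile of the Matérn kernel with regularity `ν` and length-scale `l`, extended by continuity
by the value `1` at the origin. -/
def maternProfile (d : ℕ) (ν l : ℝ) (x : EuclideanSpace ℝ (Fin d)) : ℝ :=
  if x = 0 then 1
  else 2 ^ (1 - ν) / Real.Gamma ν * (√(2 * ν) * ‖x‖ / l) ^ ν * besselK ν (√(2 * ν) * ‖x‖ / l)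

end

/-! The spectral density `g = 𝓕 κ` is nonnegative by the lower decay bound, and integrable because
the rate `s` exceeds `d / 2`. Fourier inversion gives `κ (x - y) = ⟪Φ x, Φ y⟫` with `Φ x = exp (2πi
⟪·, x⟫) √g` in `L²`. Hence every `f` in the RKHS is `f x = ⟪Φ x, F⟫ = Re 𝓕 (√g F) x` for some `F`
with `‖F‖ ≤ ‖f‖` (`exists_eq_inner_of_kernel_eq_inner`, `inner_spectralFeatureLp`).

Put `α = s - d / 2` and let `l` be the largest integer below `α`. Cauchy-Schwarz bounds `∫ ‖v‖ ^ j
‖√g F‖` by `(∫ ‖v‖ ^ (2j) g) ^ (1/2) ‖F‖`, finite for `j < α`; this controls the derivatives up to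
order `l`. A difference of order `p` with step of size `ρ` inserts the factor `min 1 ((ρ ‖v‖) ^ p)`,
and rescaling `v` by `ρ` yields `ρ ^ (α - l)`, provided `l < α < l + p`
(`exists_integral_min_mul_norm_sqrt_mul_le`). First differences (`p = 1`) suffice for non-integer
`α`. For integer `α` one has `α = l + 1` and `p = 2` is needed, whence the Zygmund seminorm. All
this is `exists_holderENorm_le`.

The Matérn profile is a Gamma mixture of Gaussians. Fubini turns its Fourier transform into a Gamma
integral, a constant times `(1 + ‖ω‖² / (2ν / l²)) ^ (-(ν + d / 2))`. The decay is then explicit,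
positive definiteness follows from the feature map, and the general embedding applies. -/

/-! ### Bochner representation and feature maps -/

section SpectralRepresentation

variable {V : Type*} [NormedAddCommGroup V] [InnerProductSpace ℝ V]

/-- The feature map `x ↦ exp (2πi ⟪·, x⟫) √g` of the translation-invariant kernel with spectral
density `g`. -/
noncomputable def spectralFeature (g : V → ℝ) (x ξ : V) : ℂ := (𝐞 (inner ℝ ξ x) : ℂ) * (√(g ξ) : ℝ)

theorem norm_spectralFeature (g : V → ℝ) (x ξ : V) : ‖spectralFeature g x ξ‖ = √(g ξ) := by
  rw [spectralFeature, norm_mul, Circle.norm_coe, one_mul, Complex.norm_real, Real.norm_eq_abs,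
    abs_of_nonneg (Real.sqrt_nonneg _)]

variable [FiniteDimensional ℝ V] [MeasurableSpace V] [BorelSpace V]

theorem memLp_spectralFeature {g : V → ℝ} (hg : Integrable g) (h0 : ∀ ξ, 0 ≤ g ξ) (x : V) :
    MemLp (spectralFeature g x) 2 volume := by
  have hm : AEStronglyMeasurable (spectralFeature g x) volume := by
    refine AEStronglyMeasurable.mul ?_ ?_
    · exact (Continuous.comp continuous_subtype_val (Real.continuous_fourierChar.comp
        (by fun_prop : Continuous fun ξ : V => (inner ℝ ξ x : ℝ)))).aestronglyMeasurable
    · exact Complex.continuous_ofReal.comp_aestronglyMeasurable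
        (Real.continuous_sqrt.comp_aestronglyMeasurable hg.1)
  rw [memLp_two_iff_integrable_sq_norm hm]
  simpa only [norm_spectralFeature, Real.sq_sqrt (h0 _)] using hg

/-- The feature map as a map into `L²`. -/
noncomputable def spectralFeatureLp {g : V → ℝ} (hg : Integrable g) (h0 : ∀ ξ, 0 ≤ g ξ) (x : V) :
    Lp ℂ 2 (volume : Measure V) :=
  (memLp_spectralFeature hg h0 x).toLp

/-- The real inner product on `ℂ` conjugates its first argument inside a real part, and the
conjugate of the character in the feature is the Fourier kernel. Smoothness of RKHS functions
thereby becomes decay of `√g F`. -/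
theorem inner_spectralFeatureLp {g : V → ℝ} (hg : Integrable g) (h0 : ∀ ξ, 0 ≤ g ξ) (x : V)
    (F : Lp ℂ 2 (volume : Measure V)) :
    inner ℝ (spectralFeatureLp hg h0 x) F = (𝓕 (fun ξ => (√(g ξ) : ℂ) * F ξ) x).re := by
  have hae : (fun ξ => (inner ℝ (spectralFeatureLp hg h0 x ξ) (F ξ) : ℝ)) =ᵐ[volume]
      fun ξ => (𝐞 (-inner ℝ ξ x) • ((√(g ξ) : ℂ) * F ξ)).re := by
    filter_upwards [(memLp_spectralFeature hg h0 x).coeFn_toLp] with ξ hξ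
    rw [spectralFeatureLp, hξ, Complex.inner, spectralFeature, Circle.smul_def, smul_eq_mul,
      map_mul, Complex.conj_ofReal, AddChar.map_neg_eq_inv, Circle.coe_inv_eq_conj]
    congr 1
    ring
  have hint : Integrable fun ξ => 𝐞 (-inner ℝ ξ x) • ((√(g ξ) : ℂ) * F ξ) := by
    -- The integrand is the feature at `-x` times `F`, a product of two `L²` functions.
    have h := (memLp_spectralFeature hg h0 (-x)).integrable_mul (Lp.memLp F)
    refine h.congr (.of_forall fun ξ => ?_)
    simp only [Pi.mul_apply, spectralFeature, inner_neg_right, Circle.smul_def, smul_eq_mul,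
      mul_assoc]
  rw [L2.inner_def, integral_congr_ae hae, Real.fourier_eq]
  exact Complex.reCLM.integral_comp_comm hint

theorem inner_spectralFeatureLp_spectralFeatureLp {g : V → ℝ} (hg : Integrable g)
    (h0 : ∀ ξ, 0 ≤ g ξ) (x y : V) :
    inner ℝ (spectralFeatureLp hg h0 x) (spectralFeatureLp hg h0 y) =
      (𝓕⁻ (fun ξ => (g ξ : ℂ)) (y - x)).re := by
  rw [inner_spectralFeatureLp, Real.fourier_eq, Real.fourierInv_eq]
  congr 1
  refine integral_congr_ae ?_
  filter_upwards [(memLp_spectralFeature hg h0 y).coeFn_toLp] with ξ hξ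
  rw [spectralFeatureLp, hξ, spectralFeature, Circle.smul_def, Circle.smul_def, inner_sub_right,
    sub_eq_add_neg, AddChar.map_add_eq_mul, Circle.coe_mul, smul_eq_mul, smul_eq_mul]
  have : (g ξ : ℂ) = √(g ξ) * √(g ξ) := by rw [← Complex.ofReal_mul, Real.mul_self_sqrt (h0 ξ)]
  rw [this]
  ring

/-- For even real `κ`, conjugating the integrand amounts to the reflection `v ↦ -v`. -/
theorem fourier_ofReal_im_eq_zero {κ : V → ℝ} (heven : ∀ x, κ (-x) = κ x) (ξ : V) :
    (𝓕 (fun x => (κ x : ℂ)) ξ).im = 0 := by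
  rw [← Complex.conj_eq_iff_im, Real.fourier_eq, ← integral_conj, ← integral_neg_eq_self]
  congr 1
  ext v
  rw [Circle.smul_def, Circle.smul_def, smul_eq_mul, smul_eq_mul, map_mul, Complex.conj_ofReal,
    heven, inner_neg_left, neg_neg, ← Circle.coe_inv_eq_conj, AddChar.map_neg_eq_inv]

theorem continuous_fourier {f : V → ℂ} (hf : Integrable f) : Continuous (𝓕 f) :=
  VectorFourier.fourierIntegral_continuous Real.continuous_fourierChar
    (by exact continuous_inner) hf

/-- Bochner's representation of a kernel with integrable, nonnegative spectral density. -/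
theorem eq_inner_spectralFeatureLp {κ : V → ℝ} (hc : Continuous κ) (hi : Integrable κ)
    (heven : ∀ x, κ (-x) = κ x) (hg : Integrable fun ξ => (𝓕 (fun x => (κ x : ℂ)) ξ).re)
    (h0 : ∀ ξ, 0 ≤ (𝓕 (fun x => (κ x : ℂ)) ξ).re) (x y : V) :
    κ (x - y) = inner ℝ (spectralFeatureLp hg h0 x) (spectralFeatureLp hg h0 y) := by
  have hF : (fun ξ => (((𝓕 (fun x => (κ x : ℂ)) ξ).re : ℝ) : ℂ)) = 𝓕 (fun x => (κ x : ℂ)) := by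
    ext ξ
    exact Complex.ext (by simp) (by simp [fourier_ofReal_im_eq_zero heven])
  have hinv := (Complex.continuous_ofReal.comp hc).fourierInv_fourier_eq hi.ofReal
    (by
      change Integrable (𝓕 fun x => (κ x : ℂ))
      rw [← hF]
      exact hg.ofReal)
  rw [inner_spectralFeatureLp_spectralFeatureLp, hF]
  rw [show 𝓕⁻ (𝓕 fun x => (κ x : ℂ)) = fun x => (κ x : ℂ) from hinv, Complex.ofReal_re,
    ← heven (x - y), neg_sub]

/-- The quadratic form at `c` is the square norm of `∑ cᵢ Φ i`. -/
theorem posSemidef_of_eq_inner {X F : Type*} [NormedAddCommGroup F] [InnerProductSpace ℝ F]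
    {K : Matrix X X ℝ} (Φ : X → F) (hK : ∀ x y, K x y = inner ℝ (Φ x) (Φ y)) : K.PosSemidef := by
  refine ⟨?_, fun c => ?_⟩
  · ext x y
    simp [Matrix.conjTranspose_apply, hK, real_inner_comm]
  · have : (c.sum fun i ci => c.sum fun j cj => star ci * K i j * cj) =
        inner ℝ (c.sum fun i ci => ci • Φ i) (c.sum fun i ci => ci • Φ i) := by
      simp only [Finsupp.sum, sum_inner, inner_sum, real_inner_smul_left, real_inner_smul_right, hK,
        star_trivial]
      refine Finset.sum_congr rfl fun i _ => Finset.sum_congr rfl fun j _ => ?_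
      rw [real_inner_comm]
      ring
    rw [this]
    exact real_inner_self_nonneg

end SpectralRepresentation

/-- A feature map of the kernel of an RKHS represents its functions. -/
theorem exists_eq_inner_of_kernel_eq_inner {X H F : Type*} [NormedAddCommGroup H]
    [InnerProductSpace ℝ H] [CompleteSpace H] [RKHS ℝ H X ℝ] [NormedAddCommGroup F]
    [InnerProductSpace ℝ F] [CompleteSpace F] (Φ : X → F)
    (hK : ∀ x y, RKHS.kernel H x y 1 = inner ℝ (Φ x) (Φ y)) (f : H) :
    ∃ G : F, ‖G‖ ≤ ‖f‖ ∧ ∀ x, f x = inner ℝ (Φ x) G := by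
  -- The kernel sections and the vectors `Φ x` have the same Gram matrix, so sending one to the
  -- other is isometric on the span of the kernel sections, which is dense. Its continuous extension
  -- applied to `f` is the required `G`.
  let e : (X →₀ ℝ) →ₗ[ℝ] H := Finsupp.linearCombination ℝ fun x => RKHS.kerFun H x 1
  let φ : (X →₀ ℝ) →ₗ[ℝ] F := Finsupp.linearCombination ℝ Φ
  have hinner (x y : X) : inner ℝ (RKHS.kerFun H x (1 : ℝ)) (RKHS.kerFun H y 1) =
      inner ℝ (Φ x) (Φ y) := by
    rw [← RKHS.kernel_inner, hK]
    simp [real_inner_comm]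
  have hnorm (c : X →₀ ℝ) : ‖φ c‖ = ‖e c‖ := by
    rw [norm_eq_sqrt_real_inner, norm_eq_sqrt_real_inner]
    simp only [φ, e, Finsupp.linearCombination_apply, Finsupp.sum, sum_inner, inner_sum,
      real_inner_smul_left, real_inner_smul_right, hinner]
  have hdense : DenseRange e := by
    have h := RKHS.kerFun_dense H
    rw [← Submodule.dense_iff_topologicalClosure_eq_top] at h
    refine h.mono ?_
    rw [← LinearMap.coe_range, SetLike.coe_subset_coe, Submodule.span_le]
    rintro _ ⟨x, v, rfl⟩
    refine ⟨Finsupp.single x v, ?_⟩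
    simp only [e, Finsupp.linearCombination_single]
    rw [← map_smul, smul_eq_mul, mul_one]
  have hle (c : X →₀ ℝ) : ‖φ c‖ ≤ 1 * ‖e c‖ := by rw [one_mul, hnorm]
  refine ⟨φ.extendOfNorm e f, ?_, fun x => ?_⟩
  · simpa using LinearMap.norm_extendOfNorm_apply_le hdense 1 hle f
  -- Both sides are continuous in `f`; on the dense range of `e` they agree by the reproducing
  -- property.
  · refine congrFun (hdense.equalizer (RKHS.continuous_eval x)
      (continuous_const.inner (φ.extendOfNorm e).continuous) (funext fun c => ?_)) f
    simp only [Function.comp_apply]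
    rw [LinearMap.extendOfNorm_eq hdense ⟨1, hle⟩]
    have : e c x = inner ℝ (RKHS.kerFun H x (1 : ℝ)) (e c) := by simp
    rw [this]
    simp only [φ, e, Finsupp.linearCombination_apply, Finsupp.sum, inner_sum,
      real_inner_smul_right, hinner]

/-! ### Weighted Cauchy-Schwarz estimates for `√g F` -/

section WeightedIntegrals

theorem L2_norm_sq_eq_integral {α E : Type*} [MeasurableSpace α] {μ : Measure α}
    [NormedAddCommGroup E] [InnerProductSpace ℝ E] (F : Lp E 2 μ) :
    ‖F‖ ^ 2 = ∫ a, ‖F a‖ ^ 2 ∂μ := by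
  rw [← real_inner_self_eq_norm_sq, L2.inner_def]
  simp only [real_inner_self_eq_norm_sq]

/-- The Cauchy-Schwarz inequality for `∫ w ‖√g F‖`. -/
theorem integral_mul_norm_sqrt_mul_le {α : Type*} [MeasurableSpace α] {μ : Measure α}
    {w g M : α → ℝ} (hw : AEStronglyMeasurable w μ) (hg : AEStronglyMeasurable g μ)
    (hw0 : ∀ a, 0 ≤ w a) (hg0 : ∀ a, 0 ≤ g a) (hM : Integrable M μ)
    (hle : ∀ᵐ a ∂μ, w a ^ 2 * g a ≤ M a) (F : Lp ℂ 2 μ) :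
    Integrable (fun a => w a * ‖(√(g a) : ℂ) * F a‖) μ ∧
      ∫ a, w a * ‖(√(g a) : ℂ) * F a‖ ∂μ ≤ √(∫ a, M a ∂μ) * ‖F‖ := by
  have hm : AEStronglyMeasurable (fun a => w a * √(g a)) μ :=
    hw.mul (Real.continuous_sqrt.comp_aestronglyMeasurable hg)
  have hsq (a : α) : (w a * √(g a)) ^ 2 = w a ^ 2 * g a := by
    rw [mul_pow, Real.sq_sqrt (hg0 a)]
  have hi : Integrable (fun a => (w a * √(g a)) ^ 2) μ := by
    refine hM.mono' (hm.pow 2) ?_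
    filter_upwards [hle] with a ha
    rw [Real.norm_of_nonneg (sq_nonneg _), hsq]
    exact ha
  have hL : MemLp (fun a => w a * √(g a)) 2 μ := (memLp_two_iff_integrable_sq hm).2 hi
  have heq : (fun a => w a * ‖(√(g a) : ℂ) * F a‖) = fun a => (w a * √(g a)) * ‖F a‖ := by
    ext a
    rw [norm_mul, Complex.norm_real, Real.norm_of_nonneg (Real.sqrt_nonneg _), mul_assoc]
  rw [heq]
  refine ⟨hL.integrable_mul (Lp.memLp F).norm, ?_⟩
  have h := integral_mul_le_Lp_mul_Lq_of_nonneg (μ := μ) (Real.HolderConjugate.two_two)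
    (f := fun a => w a * √(g a)) (g := fun a => ‖F a‖)
    (.of_forall fun a => mul_nonneg (hw0 a) (Real.sqrt_nonneg _))
    (.of_forall fun a => norm_nonneg _) (by simpa using hL) (by simpa using (Lp.memLp F).norm)
  refine h.trans ?_
  simp only [Real.rpow_two, ← Real.sqrt_eq_rpow]
  rw [← L2_norm_sq_eq_integral, Real.sqrt_sq (norm_nonneg F)]
  refine mul_le_mul_of_nonneg_right (Real.sqrt_le_sqrt ?_) (norm_nonneg F)
  refine integral_mono_ae hi hM ?_
  filter_upwards [hle] with a ha
  rw [hsq]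
  exact ha

variable {V : Type*} [NormedAddCommGroup V] [InnerProductSpace ℝ V] [FiniteDimensional ℝ V]
  [MeasurableSpace V] [BorelSpace V]

/-- In polar coordinates the integrand is `r ^ (n - 1 + 2p - q)` on `(0, 1]` and `r ^ (n - 1 - q)`
beyond; `hqp` gives convergence at the origin and `hq` at infinity. -/
theorem integrable_min_one_norm_pow_sq_mul_rpow [Nontrivial V] {p : ℕ} {q : ℝ}
    (hq : (Module.finrank ℝ V : ℝ) < q) (hqp : q < Module.finrank ℝ V + 2 * p) :
    Integrable fun v : V => min 1 (‖v‖ ^ p) ^ 2 * ‖v‖ ^ (-q) := by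
  rw [integrable_fun_norm_addHaar (volume : Measure V)
    (f := fun y : ℝ => min 1 (y ^ p) ^ 2 * y ^ (-q))]
  set n := Module.finrank ℝ V
  have hn : 1 ≤ n := Module.finrank_pos
  have hcast : ((n - 1 : ℕ) : ℝ) = n - 1 := by push_cast [hn]; ring
  rw [← Set.Ioc_union_Ioi_eq_Ioi zero_le_one]
  refine IntegrableOn.union ?_ ?_
  · have h : IntegrableOn (fun y : ℝ => y ^ ((n : ℝ) - 1 + 2 * p - q)) (Set.Ioc 0 1) :=
      (intervalIntegrable_iff_integrableOn_Ioc_of_le zero_le_one).1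
        (intervalIntegral.intervalIntegrable_rpow' (by linarith))
    refine h.congr_fun (fun y hy => ?_) measurableSet_Ioc
    have hy0 : 0 < y := hy.1
    simp only [smul_eq_mul]
    rw [min_eq_right (pow_le_one₀ hy0.le hy.2), ← pow_mul, ← mul_assoc, ← pow_add,
      ← Real.rpow_natCast, ← Real.rpow_add hy0]
    push_cast [hcast]
    congr 1
    ring
  · have h : IntegrableOn (fun y : ℝ => y ^ ((n : ℝ) - 1 - q)) (Set.Ioi 1) :=
      integrableOn_Ioi_rpow_of_lt (by linarith) zero_lt_one
    refine h.congr_fun (fun y hy => ?_) measurableSet_Ioi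
    have hy1 : 1 ≤ y := (Set.mem_Ioi.1 hy).le
    have hy0 : 0 < y := zero_lt_one.trans_le hy1
    simp only [smul_eq_mul]
    rw [min_eq_left (one_le_pow₀ hy1), one_pow, one_mul,
      ← Real.rpow_natCast, ← Real.rpow_add hy0, hcast]
    congr 1

variable {g : V → ℝ} {c s : ℝ}

/-- Since `‖v‖ ^ (2j) ≤ (1 + ‖v‖²) ^ j`, the Cauchy-Schwarz weight is at most `c (1 + ‖v‖²) ^ (j -
s)`, integrable because `2 (s - j)` exceeds the dimension. -/
theorem exists_integral_pow_mul_norm_sqrt_mul_le (hg : AEStronglyMeasurable g volume)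
    (hg0 : ∀ v, 0 ≤ g v) (hgc : ∀ v, g v ≤ c * (1 + ‖v‖ ^ 2) ^ (-s)) {j : ℕ}
    (hj : (j : ℝ) < s - Module.finrank ℝ V / 2) :
    ∃ A : ℝ, 0 ≤ A ∧ ∀ F : Lp ℂ 2 (volume : Measure V),
      Integrable (fun v => ‖v‖ ^ j * ‖(√(g v) : ℂ) * F v‖) ∧
        ∫ v, ‖v‖ ^ j * ‖(√(g v) : ℂ) * F v‖ ≤ A * ‖F‖ := by
  have hM : Integrable fun v : V => c * (1 + ‖v‖ ^ 2) ^ (-(2 * (s - j)) / 2) :=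
    (integrable_rpow_neg_one_add_norm_sq (by linarith)).const_mul c
  refine ⟨_, Real.sqrt_nonneg _, fun F => integral_mul_norm_sqrt_mul_le
    (by fun_prop : Continuous fun v : V => ‖v‖ ^ j).aestronglyMeasurable hg
    (fun v => by positivity) hg0 hM (.of_forall fun v => ?_) F⟩
  have h1 : 0 < 1 + ‖v‖ ^ 2 := by positivity
  calc (‖v‖ ^ j) ^ 2 * g v ≤ (1 + ‖v‖ ^ 2) ^ j * (c * (1 + ‖v‖ ^ 2) ^ (-s)) := by
        refine mul_le_mul ?_ (hgc v) (hg0 v) (by positivity)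
        rw [← pow_mul, mul_comm j 2, pow_mul]
        exact pow_le_pow_left₀ (by positivity) (by linarith) j
    _ = c * (1 + ‖v‖ ^ 2) ^ (-(2 * (s - j)) / 2) := by
        rw [mul_left_comm, ← Real.rpow_natCast, ← Real.rpow_add h1]
        congr 2
        ring

/-- Bounding `g` by the homogeneous `c ‖v‖ ^ (-2s)` makes the dependence on `ρ` exact: the
substitution `v ↦ ρ v` gives `ρ ^ (2 (s - j) - n)` for the squared weight, and its square root is
the stated power. -/
theorem exists_integral_min_mul_norm_sqrt_mul_le [Nontrivial V]
    (hg : AEStronglyMeasurable g volume)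
    (hg0 : ∀ v, 0 ≤ g v) (hgc : ∀ v, g v ≤ c * (1 + ‖v‖ ^ 2) ^ (-s)) (hc : 0 ≤ c) (hs : 0 ≤ s)
    {j p : ℕ} (hj : (j : ℝ) < s - Module.finrank ℝ V / 2)
    (hp : s - Module.finrank ℝ V / 2 < j + p) :
    ∃ A : ℝ, 0 ≤ A ∧ ∀ ρ : ℝ, 0 < ρ → ∀ F : Lp ℂ 2 (volume : Measure V),
      ∫ v, min 1 ((ρ * ‖v‖) ^ p) * (‖v‖ ^ j * ‖(√(g v) : ℂ) * F v‖) ≤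
        A * ρ ^ (s - Module.finrank ℝ V / 2 - j) * ‖F‖ := by
  set n := Module.finrank ℝ V with hn
  set q : ℝ := 2 * (s - j) with hq
  set M : V → ℝ := fun v => min 1 (‖v‖ ^ p) ^ 2 * ‖v‖ ^ (-q) with hMdef
  have hM : Integrable M := integrable_min_one_norm_pow_sq_mul_rpow (by linarith) (by linarith)
  have hJ : 0 ≤ ∫ v, M v := integral_nonneg fun v => by positivity
  refine ⟨√(c * ∫ v, M v), Real.sqrt_nonneg _, fun ρ hρ F => ?_⟩
  have h := (integral_mul_norm_sqrt_mul_le (w := fun v => min 1 ((ρ * ‖v‖) ^ p) * ‖v‖ ^ j)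
    (M := fun v => c * ρ ^ q * M (ρ • v))
    (by fun_prop : Continuous fun v : V => min 1 ((ρ * ‖v‖) ^ p) * ‖v‖ ^ j).aestronglyMeasurable hg
    (fun v => by positivity) hg0 ((hM.comp_smul hρ.ne').const_mul _) ?_ F).2
  · simp only [mul_assoc] at h ⊢
    refine h.trans (le_of_eq ?_)
    rw [← mul_assoc (√_)]
    congr 1
    rw [integral_const_mul, integral_const_mul, Measure.integral_comp_smul, ← hn, smul_eq_mul,
      abs_of_pos (by positivity)]
    have : c * (ρ ^ q * ((ρ ^ n)⁻¹ * ∫ v, M v)) =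
        (c * ∫ v, M v) * (ρ ^ (s - n / 2 - j)) ^ 2 := by
      have h2 : (ρ ^ (s - n / 2 - j)) ^ 2 = ρ ^ q * (ρ ^ n)⁻¹ := by
        rw [← Real.rpow_natCast ρ n, ← Real.rpow_neg hρ.le, ← Real.rpow_add hρ,
          ← Real.rpow_mul_natCast hρ.le]
        congr 1
        push_cast
        ring
      rw [h2]
      ring
    rw [this, Real.sqrt_mul (by positivity), Real.sqrt_sq (by positivity)]
  -- The homogeneous bound can fail at the origin, where the negative power takes the value `0`.
  · have h0 : ∀ᵐ v : V, v ≠ 0 := by simp [ae_iff, measure_singleton]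
    filter_upwards [h0] with v hv
    have hv0 : 0 < ‖v‖ := norm_pos_iff.2 hv
    simp only [hMdef, norm_smul, Real.norm_of_nonneg hρ.le]
    have hgv : g v ≤ c * ‖v‖ ^ (-(2 * s)) := by
      refine (hgc v).trans (mul_le_mul_of_nonneg_left ?_ hc)
      rw [show -(2 * s) = 2 * -s by ring, Real.rpow_mul hv0.le, Real.rpow_two]
      exact Real.rpow_le_rpow_of_nonpos (by positivity) (by linarith) (by linarith)
    calc (min 1 ((ρ * ‖v‖) ^ p) * ‖v‖ ^ j) ^ 2 * g v
        ≤ (min 1 ((ρ * ‖v‖) ^ p) * ‖v‖ ^ j) ^ 2 * (c * ‖v‖ ^ (-(2 * s))) := by gcongr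
      _ = c * min 1 ((ρ * ‖v‖) ^ p) ^ 2 * (‖v‖ ^ (j * 2) * ‖v‖ ^ (-(2 * s))) := by ring
      _ = c * min 1 ((ρ * ‖v‖) ^ p) ^ 2 * (ρ ^ q * (ρ * ‖v‖) ^ (-q)) := by
        rw [← Real.rpow_natCast ‖v‖, ← Real.rpow_add hv0, Real.mul_rpow hρ.le hv0.le, ← mul_assoc (ρ ^ q),
          ← Real.rpow_add hρ, add_neg_cancel, Real.rpow_zero, one_mul]
        congr 2
        push_cast
        ring
      _ = c * ρ ^ q * (min 1 ((ρ * ‖v‖) ^ p) ^ 2 * (ρ * ‖v‖) ^ (-q)) := by ring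

end WeightedIntegrals

/-! ### First and second differences of a Fourier transform -/

section FourierDifferences

variable {V W : Type*} [NormedAddCommGroup V] [InnerProductSpace ℝ V] [FiniteDimensional ℝ V]
  [MeasurableSpace V] [BorelSpace V] [NormedAddCommGroup W] {P : V → W}

theorem integrable_min_mul_norm (hP : Integrable P) (ρ : ℝ) (hρ : 0 ≤ ρ) (p : ℕ) :
    Integrable fun v => 4 * (min 1 ((ρ * ‖v‖) ^ p) * ‖P v‖) := by
  refine (hP.norm.mono' ?_ (.of_forall fun v => ?_)).const_mul 4
  · exact (by fun_prop : Continuous fun v : V => min 1 ((ρ * ‖v‖) ^ p)).aestronglyMeasurable.mul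
      hP.norm.1
  · rw [Real.norm_of_nonneg (by positivity)]
    exact mul_le_of_le_one_left (norm_nonneg _) (min_le_left _ _)

variable [NormedSpace ℂ W]

theorem integrable_fourierChar_smul (hP : Integrable P) (x : V) :
    Integrable fun v => 𝐞 (-inner ℝ v x) • P v := by
  refine (Real.fourierIntegral_convergent_iff x).2 hP

theorem norm_fourierChar_sub_one_le (t : ℝ) : ‖(𝐞 t : ℂ) - 1‖ ≤ 2 * min 1 (|2 * Real.pi * t|) := by
  have h1 : ‖(𝐞 t : ℂ) - 1‖ ≤ 2 := (norm_sub_le _ _).trans (by simp [Circle.norm_coe]; norm_num)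
  have h2 : ‖(𝐞 t : ℂ) - 1‖ ≤ |2 * Real.pi * t| := by
    rw [Real.fourierChar_apply, mul_comm _ Complex.I]
    exact Real.norm_exp_I_mul_ofReal_sub_one_le
  rcases min_cases 1 (|2 * Real.pi * t|) with h | h <;> rw [h.1] <;>
    linarith [abs_nonneg (2 * Real.pi * t)]

/-- Factoring out the character at `y` leaves `𝐞 ⟪v, y - x⟫ - 1`. The constant `2` would do; `4`
matches the second-difference bound. -/
theorem norm_fourier_sub_le (hP : Integrable P) (x y : V) :
    ‖𝓕 P x - 𝓕 P y‖ ≤ ∫ v, 4 * (min 1 ((2 * Real.pi * ‖x - y‖ * ‖v‖) ^ 1) * ‖P v‖) := by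
  rw [Real.fourier_eq, Real.fourier_eq,
    ← integral_sub (integrable_fourierChar_smul hP x) (integrable_fourierChar_smul hP y)]
  refine norm_integral_le_of_norm_le (integrable_min_mul_norm hP _ (by positivity) 1)
    (.of_forall fun v => ?_)
  have hch : (𝐞 (-inner ℝ v x) : ℂ) = 𝐞 (-inner ℝ v y) * 𝐞 (inner ℝ v (y - x)) := by
    rw [← Circle.coe_mul, ← AddChar.map_add_eq_mul, inner_sub_right]
    congr 2
    ring
  have ht : |2 * Real.pi * inner ℝ v (y - x)| ≤ 2 * Real.pi * ‖x - y‖ * ‖v‖ := by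
    rw [abs_mul, abs_of_pos Real.two_pi_pos, mul_assoc (2 * Real.pi), norm_sub_rev,
      mul_comm ‖y - x‖]
    exact mul_le_mul_of_nonneg_left (abs_real_inner_le_norm _ _) Real.two_pi_pos.le
  rw [Circle.smul_def, Circle.smul_def, ← sub_smul, norm_smul, ← mul_assoc, hch]
  refine mul_le_mul_of_nonneg_right ?_ (norm_nonneg _)
  rw [← mul_sub_one, norm_mul, Circle.norm_coe, one_mul, pow_one]
  refine (norm_fourierChar_sub_one_le _).trans ?_
  have := min_le_min_left 1 ht
  have h0 : 0 ≤ min 1 (2 * Real.pi * ‖x - y‖ * ‖v‖) := by positivity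
  linarith

/-- With `a = ⟪v, x⟫` and `b = ⟪v, y⟫`, the second difference of characters is the perfect square `𝐞
(-a) (𝐞 ((a - b) / 2) - 1) ^ 2`, so the first-order bound enters squared. -/
theorem norm_fourier_add_sub_midpoint_le (hP : Integrable P) (x y : V) :
    ‖𝓕 P x + 𝓕 P y - (𝓕 P (midpoint ℝ x y) + 𝓕 P (midpoint ℝ x y))‖ ≤
      ∫ v, 4 * (min 1 ((2 * Real.pi * ‖x - y‖ * ‖v‖) ^ 2) * ‖P v‖) := by
  simp only [Real.fourier_eq]
  have hadd (x y : V) : Integrable fun v => 𝐞 (-inner ℝ v x) • P v + 𝐞 (-inner ℝ v y) • P v :=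
    (integrable_fourierChar_smul hP x).add (integrable_fourierChar_smul hP y)
  rw [← integral_add (integrable_fourierChar_smul hP x) (integrable_fourierChar_smul hP y),
    ← integral_add (integrable_fourierChar_smul hP _) (integrable_fourierChar_smul hP _),
    ← integral_sub (hadd x y) (hadd _ _)]
  refine norm_integral_le_of_norm_le (integrable_min_mul_norm hP _ (by positivity) 2)
    (.of_forall fun v => ?_)
  have hmid : (inner ℝ v (midpoint ℝ x y) : ℝ) = (inner ℝ v x + inner ℝ v y) / 2 := by
    rw [midpoint_eq_smul_add, real_inner_smul_right, inner_add_right, invOf_eq_inv]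
    ring
  set a : ℝ := inner ℝ v x with ha
  set b : ℝ := inner ℝ v y with hb
  have hm : (𝐞 (-((a + b) / 2)) : ℂ) = 𝐞 (-a) * 𝐞 ((a - b) / 2) := by
    rw [← Circle.coe_mul, ← AddChar.map_add_eq_mul]
    congr 2
    ring
  have hb' : (𝐞 (-b) : ℂ) = 𝐞 (-a) * 𝐞 ((a - b) / 2) * 𝐞 ((a - b) / 2) := by
    rw [← Circle.coe_mul, ← Circle.coe_mul, ← AddChar.map_add_eq_mul, ← AddChar.map_add_eq_mul]
    congr 2
    ring
  have ht : |2 * Real.pi * ((a - b) / 2)| ≤ 2 * Real.pi * ‖x - y‖ * ‖v‖ := by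
    have h := abs_real_inner_le_norm v (x - y)
    rw [inner_sub_right, ← ha, ← hb] at h
    rw [abs_mul, abs_of_pos Real.two_pi_pos, mul_assoc (2 * Real.pi), mul_comm ‖x - y‖, abs_div, abs_two]
    refine mul_le_mul_of_nonneg_left ?_ Real.two_pi_pos.le
    linarith [abs_nonneg (a - b)]
  rw [hmid]
  simp only [Circle.smul_def]
  rw [← add_smul, ← add_smul, ← sub_smul, norm_smul, ← mul_assoc, hm, hb']
  refine mul_le_mul_of_nonneg_right ?_ (norm_nonneg _)
  rw [show (𝐞 (-a) : ℂ) + 𝐞 (-a) * 𝐞 ((a - b) / 2) * 𝐞 ((a - b) / 2) -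
      (𝐞 (-a) * 𝐞 ((a - b) / 2) + 𝐞 (-a) * 𝐞 ((a - b) / 2)) =
      𝐞 (-a) * ((𝐞 ((a - b) / 2) : ℂ) - 1) ^ 2 by ring, norm_mul, Circle.norm_coe, one_mul,
    norm_pow]
  have h0 : 0 ≤ min 1 (|2 * Real.pi * ((a - b) / 2)|) := by positivity
  calc ‖(𝐞 ((a - b) / 2) : ℂ) - 1‖ ^ 2 ≤ (2 * min 1 (|2 * Real.pi * ((a - b) / 2)|)) ^ 2 := by
        gcongr
        exact norm_fourierChar_sub_one_le _
    _ = 4 * min 1 (|2 * Real.pi * ((a - b) / 2)|) ^ 2 := by ring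
    _ ≤ 4 * min 1 ((2 * Real.pi * ‖x - y‖ * ‖v‖) ^ 2) := by
        gcongr
        refine le_min (pow_le_one₀ h0 (min_le_left _ _)) ?_
        exact pow_le_pow_left₀ h0 ((min_le_right _ _).trans ht) 2

end FourierDifferences

/-! ### Derivatives of the real part of a Fourier transform -/

section FourierDerivatives

variable {V : Type*} [NormedAddCommGroup V] [InnerProductSpace ℝ V]

open VectorFourier in
theorem norm_fourierPowSMulRight_innerSL_le (h : V → ℂ) (v : V) (j : ℕ) :
    ‖fourierPowSMulRight (innerSL ℝ) h v j‖ ≤ (2 * Real.pi) ^ j * (‖v‖ ^ j * ‖h v‖) := by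
  refine (norm_fourierPowSMulRight_le (innerSL ℝ) h v j).trans ?_
  rw [mul_assoc]
  have h1 : ‖(innerSL ℝ : V →L[ℝ] V →L[ℝ] ℝ)‖ ≤ 1 := norm_innerSL_le ℝ
  have : 2 * Real.pi * ‖(innerSL ℝ : V →L[ℝ] V →L[ℝ] ℝ)‖ ≤ 2 * Real.pi :=
    mul_le_of_le_one_right Real.two_pi_pos.le h1
  gcongr

theorem norm_reCLM_comp_le {j : ℕ} (T : ContinuousMultilinearMap ℝ (fun _ : Fin j => V) ℂ) :
    ‖Complex.reCLM.compContinuousMultilinearMap T‖ ≤ ‖T‖ := by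
  simpa using Complex.reCLM.norm_compContinuousMultilinearMap_le T

theorem reCLM_comp_sub {j : ℕ} (S T : ContinuousMultilinearMap ℝ (fun _ : Fin j => V) ℂ) :
    Complex.reCLM.compContinuousMultilinearMap S - Complex.reCLM.compContinuousMultilinearMap T =
      Complex.reCLM.compContinuousMultilinearMap (S - T) := by
  ext m
  simp

theorem reCLM_comp_add {j : ℕ} (S T : ContinuousMultilinearMap ℝ (fun _ : Fin j => V) ℂ) :
    Complex.reCLM.compContinuousMultilinearMap S + Complex.reCLM.compContinuousMultilinearMap T =
      Complex.reCLM.compContinuousMultilinearMap (S + T) := by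
  ext m
  simp

variable [FiniteDimensional ℝ V] [MeasurableSpace V] [BorelSpace V] {h : V → ℂ} {l : ℕ}

open VectorFourier in
theorem integrable_fourierPowSMulRight_innerSL {j : ℕ} (hm : AEStronglyMeasurable h volume)
    (hh : Integrable fun v => ‖v‖ ^ j * ‖h v‖) :
    Integrable fun v => fourierPowSMulRight (innerSL ℝ) h v j :=
  integrable_fourierPowSMulRight (innerSL ℝ) hh hm

theorem contDiff_re_fourier (hh : ∀ j ≤ l, Integrable fun v => ‖v‖ ^ j * ‖h v‖) :
    ContDiff ℝ l fun x => (𝓕 h x).re :=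
  Complex.reCLM.contDiff.comp
    (Real.contDiff_fourier (N := (l : ℕ∞)) fun j hj => hh j (by exact_mod_cast hj))

/-- Differentiation under the integral makes the derivative a Fourier transform again, with values
in multilinear maps, so the vector-valued difference bounds apply to it. -/
theorem iteratedFDeriv_re_fourier (hm : AEStronglyMeasurable h volume)
    (hh : ∀ j ≤ l, Integrable fun v => ‖v‖ ^ j * ‖h v‖) {j : ℕ} (hj : j ≤ l) (x : V) :
    iteratedFDeriv ℝ j (fun x => (𝓕 h x).re) x = Complex.reCLM.compContinuousMultilinearMap
      (𝓕 (fun v => VectorFourier.fourierPowSMulRight (innerSL ℝ) h v j) x) := by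
  have hh' : ∀ n : ℕ, (n : ℕ∞) ≤ (l : ℕ∞) → Integrable fun v => ‖v‖ ^ n * ‖h v‖ :=
    fun n hn => hh n (by exact_mod_cast hn)
  have h1 := Complex.reCLM.iteratedFDeriv_comp_left (x := x)
    (Real.contDiff_fourier hh').contDiffAt (i := j) (by exact_mod_cast hj)
  rw [Real.iteratedFDeriv_fourier hh' hm (by exact_mod_cast hj)] at h1
  exact h1

theorem norm_iteratedFDeriv_re_fourier_le (hm : AEStronglyMeasurable h volume)
    (hh : ∀ j ≤ l, Integrable fun v => ‖v‖ ^ j * ‖h v‖) {j : ℕ} (hj : j ≤ l) (x : V) :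
    ‖iteratedFDeriv ℝ j (fun x => (𝓕 h x).re) x‖ ≤
      (2 * Real.pi) ^ j * ∫ v, ‖v‖ ^ j * ‖h v‖ := by
  rw [iteratedFDeriv_re_fourier hm hh hj]
  refine (norm_reCLM_comp_le _).trans ?_
  refine (VectorFourier.norm_fourierIntegral_le_integral_norm _ _ _ _ _).trans ?_
  rw [← integral_const_mul]
  exact integral_mono (integrable_fourierPowSMulRight_innerSL hm (hh j hj)).norm
    ((hh j hj).const_mul _) fun v => norm_fourierPowSMulRight_innerSL_le h v j

theorem integral_min_mul_norm_fourierPowSMulRight_le (hm : AEStronglyMeasurable h volume)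
    (hl : Integrable fun v => ‖v‖ ^ l * ‖h v‖) {ρ : ℝ} (hρ : 0 ≤ ρ) (p : ℕ) :
    ∫ v, 4 * (min 1 ((ρ * ‖v‖) ^ p) * ‖VectorFourier.fourierPowSMulRight (innerSL ℝ) h v l‖) ≤
      4 * (2 * Real.pi) ^ l * ∫ v, min 1 ((ρ * ‖v‖) ^ p) * (‖v‖ ^ l * ‖h v‖) := by
  rw [← integral_const_mul]
  have hi := integrable_min_mul_norm (P := fun v => ‖v‖ ^ l * ‖h v‖) hl ρ hρ p
  simp only [norm_mul, norm_pow, norm_norm] at hi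
  refine integral_mono (integrable_min_mul_norm
    (integrable_fourierPowSMulRight_innerSL hm hl) ρ hρ p)
    ((hi.const_mul ((2 * Real.pi) ^ l)).congr (.of_forall fun v => ?_)) fun v => ?_
  · ring
  · have := norm_fourierPowSMulRight_innerSL_le h v l
    have h0 : 0 ≤ min 1 ((ρ * ‖v‖) ^ p) := by positivity
    have := mul_le_mul_of_nonneg_left this h0
    linarith

theorem norm_iteratedFDeriv_re_fourier_sub_le (hm : AEStronglyMeasurable h volume)
    (hh : ∀ j ≤ l, Integrable fun v => ‖v‖ ^ j * ‖h v‖) (x y : V) :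
    ‖iteratedFDeriv ℝ l (fun x => (𝓕 h x).re) x - iteratedFDeriv ℝ l (fun x => (𝓕 h x).re) y‖ ≤
      4 * (2 * Real.pi) ^ l *
        ∫ v, min 1 ((2 * Real.pi * ‖x - y‖ * ‖v‖) ^ 1) * (‖v‖ ^ l * ‖h v‖) := by
  rw [iteratedFDeriv_re_fourier hm hh le_rfl, iteratedFDeriv_re_fourier hm hh le_rfl,
    reCLM_comp_sub]
  refine (norm_reCLM_comp_le _).trans ((norm_fourier_sub_le
    (integrable_fourierPowSMulRight_innerSL hm (hh l le_rfl)) x y).trans ?_)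
  exact integral_min_mul_norm_fourierPowSMulRight_le hm (hh l le_rfl) (by positivity) 1

theorem norm_iteratedFDeriv_re_fourier_add_sub_midpoint_le (hm : AEStronglyMeasurable h volume)
    (hh : ∀ j ≤ l, Integrable fun v => ‖v‖ ^ j * ‖h v‖) (x y : V) :
    ‖iteratedFDeriv ℝ l (fun x => (𝓕 h x).re) x + iteratedFDeriv ℝ l (fun x => (𝓕 h x).re) y -
        (2 : ℝ) • iteratedFDeriv ℝ l (fun x => (𝓕 h x).re) (midpoint ℝ x y)‖ ≤
      4 * (2 * Real.pi) ^ l *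
        ∫ v, min 1 ((2 * Real.pi * ‖x - y‖ * ‖v‖) ^ 2) * (‖v‖ ^ l * ‖h v‖) := by
  rw [two_smul]
  simp only [iteratedFDeriv_re_fourier hm hh le_rfl, reCLM_comp_add, reCLM_comp_sub]
  refine (norm_reCLM_comp_le _).trans ((norm_fourier_add_sub_midpoint_le
    (integrable_fourierPowSMulRight_innerSL hm (hh l le_rfl)) x y).trans ?_)
  exact integral_min_mul_norm_fourierPowSMulRight_le hm (hh l le_rfl) (by positivity) 2

end FourierDerivatives

/-! ### Derivatives within the unit cube -/

section UnitCube

variable {d : ℕ}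

theorem convex_unitCube : Convex ℝ (unitCube d) := by
  intro x hx y hy a b ha hb hab i
  simpa using (convex_Icc (0 : ℝ) 1) (hx i) (hy i) ha hb hab

/-- The cube is convex and its centre is an interior point. Derivatives within the cube are
therefore unambiguous and agree there with those of any smooth extension. -/
theorem uniqueDiffOn_unitCube : UniqueDiffOn ℝ (unitCube d) := by
  refine uniqueDiffOn_convex convex_unitCube ⟨WithLp.toLp 2 fun _ => 1 / 2, ?_⟩
  rw [mem_interior]
  refine ⟨⋂ i, {x | x i ∈ Set.Ioo (0 : ℝ) 1}, fun x hx i => ?_,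
    isOpen_iInter_of_finite fun i => ?_, ?_⟩
  · exact Set.Ioo_subset_Icc_self (Set.mem_iInter.1 hx i)
  · exact isOpen_Ioo.preimage (by fun_prop)
  · simp only [Set.mem_iInter, Set.mem_ofPred_eq, Set.mem_Ioo]
    intro i
    norm_num

theorem zeroExtend_eqOn {f : unitCube d → ℝ} {G : EuclideanSpace ℝ (Fin d) → ℝ}
    (hG : ∀ x : unitCube d, f x = G x) : Set.EqOn (zeroExtend f) G (unitCube d) := fun x hx => by
  rw [zeroExtend, ← hG ⟨x, hx⟩]
  exact Subtype.val_injective.extend_apply f 0 ⟨x, hx⟩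

theorem cubeDeriv_eq_iteratedFDeriv {f : unitCube d → ℝ} {G : EuclideanSpace ℝ (Fin d) → ℝ}
    (hG : ∀ x : unitCube d, f x = G x) {j : ℕ} (hc : ContDiff ℝ j G)
    {x : EuclideanSpace ℝ (Fin d)} (hx : x ∈ unitCube d) :
    cubeDeriv j f x = iteratedFDeriv ℝ j G x := by
  rw [cubeDeriv, iteratedFDerivWithin_congr (zeroExtend_eqOn hG) hx,
    iteratedFDerivWithin_eq_iteratedFDeriv uniqueDiffOn_unitCube hc.contDiffAt hx]

theorem holderOrder_lt {α : ℝ} (hα : 0 < α) : (holderOrder α : ℝ) < α := by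
  -- A positive ceiling means that the truncated subtraction in `holderOrder` loses nothing.
  have h1 : 0 < ⌈α⌉₊ := Nat.ceil_pos.2 hα
  have h2 := Nat.ceil_lt_add_one hα.le
  rw [holderOrder, Nat.cast_sub h1]
  push_cast
  linarith

theorem le_holderOrder_add_one {α : ℝ} (hα : 0 < α) : α ≤ holderOrder α + 1 := by
  have h1 : 0 < ⌈α⌉₊ := Nat.ceil_pos.2 hα
  rw [holderOrder, Nat.cast_sub h1]
  push_cast
  linarith [Nat.le_ceil α]

end UnitCube

/-! ### Embedding of the RKHS into the Hölder-Zygmund space -/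

section Embedding

variable {d : ℕ}

theorem enorm_le_ofReal_mul_enorm {E F : Type*} [SeminormedAddCommGroup E]
    [SeminormedAddCommGroup F] {a : E} {b : F} {C : ℝ} (hC : 0 ≤ C) (h : ‖a‖ ≤ C * ‖b‖) :
    ‖a‖ₑ ≤ C.toNNReal * ‖b‖ₑ := by
  rw [← ofReal_norm, ← ofReal_norm]
  change _ ≤ ENNReal.ofReal C * _
  rw [← ENNReal.ofReal_mul hC]
  exact ENNReal.ofReal_le_ofReal h

/-- The Hölder-Zygmund norm of a real part of a Fourier transform `𝓕 (√g F)`. -/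
theorem exists_holderENorm_le (hd : 0 < d) {g : EuclideanSpace ℝ (Fin d) → ℝ} {c s : ℝ}
    (hg : AEStronglyMeasurable g volume) (hg0 : ∀ v, 0 ≤ g v)
    (hgc : ∀ v, g v ≤ c * (1 + ‖v‖ ^ 2) ^ (-s)) (hc : 0 ≤ c) {α : ℝ} (hα : 0 < α)
    (hs : s = α + d / 2) :
    ∃ C : ℝ≥0, ∀ (F : Lp ℂ 2 (volume : Measure (EuclideanSpace ℝ (Fin d))))
      (f : unitCube d → ℝ), (∀ x : unitCube d, f x = (𝓕 (fun ξ => (√(g ξ) : ℂ) * F ξ) x).re) →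
      ContDiffOn ℝ (holderOrder α) (zeroExtend f) (unitCube d) ∧
        holderENorm α f ≤ C * ‖F‖ₑ := by
  have : Nonempty (Fin d) := ⟨⟨0, hd⟩⟩
  set l := holderOrder α with hl
  have hlα : (l : ℝ) < α := holderOrder_lt hα
  have hαl : α ≤ l + 1 := le_holderOrder_add_one hα
  have hn : (Module.finrank ℝ (EuclideanSpace ℝ (Fin d)) : ℝ) = d := by simp
  have hsα : s - Module.finrank ℝ (EuclideanSpace ℝ (Fin d)) / 2 = α := by rw [hn, hs]; ring
  have hjex (j : ℕ) (hj : j ≤ l) := exists_integral_pow_mul_norm_sqrt_mul_le hg hg0 hgc (j := j)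
    (by rw [hsα]; exact lt_of_le_of_lt (by exact_mod_cast hj) hlα)
  choose! A hA0 hA using hjex
  -- `p` is the order of the difference in the top seminorm; `α < l + p` is convergence of the
  -- weight at the origin.
  obtain ⟨p, hp, hp1, hp2⟩ : ∃ p : ℕ, α < l + p ∧ (α = l + 1 → p = 2) ∧ (α ≠ l + 1 → p = 1) := by
    by_cases h : α = l + 1
    · exact ⟨2, by rw [h]; push_cast; linarith, fun _ => rfl, fun h' => absurd h h'⟩
    · exact ⟨1, by push_cast; exact lt_of_le_of_ne hαl h, fun h' => absurd h' h, fun _ => rfl⟩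
  obtain ⟨B, hB0, hB⟩ := exists_integral_min_mul_norm_sqrt_mul_le hg hg0 hgc hc
    (by rw [hs]; positivity) (j := l) (p := p) (by rwa [hsα]) (by rwa [hsα])
  simp only [hsα] at hB
  -- `4 (2π) ^ l` comes from the difference bounds for derivatives of order `l`; the rest is the
  -- weighted estimate at `ρ = 2π ‖x - y‖`.
  set D : ℝ := 4 * (2 * Real.pi) ^ l * (B * (2 * Real.pi) ^ (α - l)) with hD
  have hD0 : 0 ≤ D := by positivity
  refine ⟨∑ j ∈ Finset.range (l + 1), ((2 * Real.pi) ^ j * A j).toNNReal + D.toNNReal,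
    fun F f hf => ?_⟩
  set h : EuclideanSpace ℝ (Fin d) → ℂ := fun ξ => (√(g ξ) : ℂ) * F ξ with hh
  have hm : AEStronglyMeasurable h volume :=
    (Complex.continuous_ofReal.comp_aestronglyMeasurable
      (Real.continuous_sqrt.comp_aestronglyMeasurable hg)).mul (Lp.aestronglyMeasurable F)
  have hi : ∀ j ≤ l, Integrable fun v => ‖v‖ ^ j * ‖h v‖ := fun j hj => (hA j hj F).1
  have hderiv {j : ℕ} (hj : j ≤ l) {x : EuclideanSpace ℝ (Fin d)} (hx : x ∈ unitCube d) :
      cubeDeriv j f x = iteratedFDeriv ℝ j (fun x => (𝓕 h x).re) x :=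
    cubeDeriv_eq_iteratedFDeriv hf ((contDiff_re_fourier hi).of_le (by exact_mod_cast hj)) hx
  have hdiff {x y : EuclideanSpace ℝ (Fin d)} (hxy : x ≠ y) :
      4 * (2 * Real.pi) ^ l * ∫ v, min 1 ((2 * Real.pi * ‖x - y‖ * ‖v‖) ^ p) *
        (‖v‖ ^ l * ‖h v‖) ≤ D * ‖F‖ * ‖x - y‖ ^ (α - l) := by
    have h0 : 0 < ‖x - y‖ := norm_pos_iff.2 (sub_ne_zero.2 hxy)
    have := mul_le_mul_of_nonneg_left (hB (2 * Real.pi * ‖x - y‖) (by positivity) F)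
      (by positivity : 0 ≤ 4 * (2 * Real.pi) ^ l)
    refine this.trans (le_of_eq ?_)
    rw [hD, Real.mul_rpow Real.two_pi_pos.le h0.le]
    ring
  have hα0 : 0 < α - l := by linarith
  refine ⟨(contDiff_re_fourier hi).contDiffOn.congr (zeroExtend_eqOn hf), ?_⟩
  rw [holderENorm, ← hl, ENNReal.coe_add, ENNReal.ofNNReal_finsetSum, add_mul, Finset.sum_mul]
  refine add_le_add (Finset.sum_le_sum fun j hj => iSup₂_le fun x hx => ?_) ?_
  · have hj' : j ≤ l := Nat.lt_succ_iff.1 (Finset.mem_range.1 hj)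
    have := hA0 j hj'
    refine enorm_le_ofReal_mul_enorm (by positivity) ?_
    rw [hderiv hj' hx, mul_assoc]
    refine (norm_iteratedFDeriv_re_fourier_le hm hi hj' x).trans ?_
    exact mul_le_mul_of_nonneg_left (hA j hj' F).2 (by positivity)
  · have hcoe : (D.toNNReal : ℝ≥0∞) * ‖F‖ₑ = ((D.toNNReal * ‖F‖₊ : ℝ≥0) : ℝ≥0∞) := by
      rw [ENNReal.coe_mul, enorm_eq_nnnorm]
    rw [holderSeminorm, ← hl, hcoe]
    split_ifs with hint
    · obtain rfl := hp1 hint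
      refine iInf₂_le_of_le (D.toNNReal * ‖F‖₊) (fun x hx y hy => ?_) le_rfl
      have hmid : midpoint ℝ x y ∈ unitCube d := convex_unitCube.midpoint_mem hx hy
      rw [hderiv le_rfl hx, hderiv le_rfl hy, hderiv le_rfl hmid]
      -- The scaling estimate needs `ρ > 0`, so the diagonal is treated separately.
      rcases eq_or_ne x y with rfl | hxy
      · simp [two_smul]
      refine (norm_iteratedFDeriv_re_fourier_add_sub_midpoint_le hm hi x y).trans
        ((hdiff hxy).trans (le_of_eq ?_))
      rw [show α - l = 1 by linarith, Real.rpow_one, NNReal.coe_mul, Real.coe_toNNReal _ hD0,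
        coe_nnnorm]
    · obtain rfl := hp2 hint
      refine HolderWith.eHolderNorm_le fun x y => ?_
      rw [Real.coe_toNNReal _ hα0.le, hderiv le_rfl x.2, hderiv le_rfl y.2]
      rcases eq_or_ne x y with rfl | hxy
      · simp
      have hxy' : (x : EuclideanSpace ℝ (Fin d)) ≠ y := fun h => hxy (Subtype.ext h)
      rw [edist_dist, edist_dist, ENNReal.ofReal_rpow_of_nonneg dist_nonneg hα0.le,
        ← ENNReal.ofReal_coe_nnreal, ← ENNReal.ofReal_mul (NNReal.coe_nonneg _), dist_eq_norm,
        Subtype.dist_eq, dist_eq_norm]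
      refine ENNReal.ofReal_le_ofReal ((norm_iteratedFDeriv_re_fourier_sub_le hm hi _ _).trans
        ((hdiff hxy').trans (le_of_eq ?_)))
      rw [NNReal.coe_mul, Real.coe_toNNReal _ hD0, coe_nnnorm]

theorem IsKernelWithFourierDecay.even {κ : EuclideanSpace ℝ (Fin d) → ℝ} {s : ℝ}
    (hκ : IsKernelWithFourierDecay κ s) (x : EuclideanSpace ℝ (Fin d)) : κ (-x) = κ x := by
  have h := hκ.posDef.isHermitian.apply 0 x
  simpa using h.symm

/-- Polynomial decay in the angular-frequency convention, for the spectral density. -/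
theorem re_fourier_bounds_of_decay {κ : EuclideanSpace ℝ (Fin d) → ℝ} {s c₁ c₂ : ℝ} (hs : 0 ≤ s)
    (hc₁ : 0 < c₁) (hc₁₂ : c₁ ≤ c₂) (hdec : ∀ ω : EuclideanSpace ℝ (Fin d),
      c₁ * (1 + ‖ω‖ ^ 2) ^ (-s) ≤ (angularFourier κ ω).re ∧
        (angularFourier κ ω).re ≤ c₂ * (1 + ‖ω‖ ^ 2) ^ (-s)) (ξ : EuclideanSpace ℝ (Fin d)) :
    0 ≤ (𝓕 (fun x => (κ x : ℂ)) ξ).re ∧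
      (𝓕 (fun x => (κ x : ℂ)) ξ).re ≤ c₂ * (1 + ‖ξ‖ ^ 2) ^ (-s) := by
  -- The frequency `2πξ` converts between the two conventions; `‖2πξ‖ ≥ ‖ξ‖` then lets the upper
  -- bound keep `c₂`.
  have h := hdec ((2 * Real.pi) • ξ)
  rw [angularFourier, smul_smul, inv_mul_cancel₀ Real.two_pi_pos.ne', one_smul] at h
  refine ⟨le_trans (by positivity) h.1,
    h.2.trans (mul_le_mul_of_nonneg_left ?_ (hc₁.le.trans hc₁₂))⟩
  refine Real.rpow_le_rpow_of_nonpos (by positivity) ?_ (by linarith)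
  rw [norm_smul, Real.norm_of_nonneg Real.two_pi_pos.le]
  gcongr
  exact le_mul_of_one_le_left (norm_nonneg _) (by linarith [Real.pi_gt_three])

theorem integrable_re_fourier_of_bounds {κ : EuclideanSpace ℝ (Fin d) → ℝ} {s c : ℝ}
    (hκ : Integrable κ) (hs : (d : ℝ) / 2 < s)
    (h : ∀ ξ, 0 ≤ (𝓕 (fun x => (κ x : ℂ)) ξ).re ∧
      (𝓕 (fun x => (κ x : ℂ)) ξ).re ≤ c * (1 + ‖ξ‖ ^ 2) ^ (-s)) :
    Integrable fun ξ => (𝓕 (fun x => (κ x : ℂ)) ξ).re := by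
  have hM := (integrable_rpow_neg_one_add_norm_sq (E := EuclideanSpace ℝ (Fin d))
    (μ := volume) (r := 2 * s) (by simp; linarith)).const_mul c
  refine hM.mono' (Complex.continuous_re.comp
    (continuous_fourier hκ.ofReal)).aestronglyMeasurable (.of_forall fun ξ => ?_)
  rw [Real.norm_of_nonneg (h ξ).1, show -(2 * s) / 2 = -s by ring]
  exact (h ξ).2

/-- The RKHS on the unit cube of a kernel with polynomial Fourier decay of real rate `s > d / 2`
embeds into `C^(s - d/2)`. -/
theorem rkhsEmbedsIntoHolder_of_decay (hd : 0 < d) {κ : EuclideanSpace ℝ (Fin d) → ℝ} {s α : ℝ}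
    (hα : 0 < α) (hs : s = α + d / 2) (hκ : IsKernelWithFourierDecay κ s) :
    RKHSEmbedsIntoHolder.{u} κ α := by
  obtain ⟨c₁, c₂, hc₁, hc₁₂, hdec⟩ := hκ.decay
  have hb := re_fourier_bounds_of_decay (by rw [hs]; positivity) hc₁ hc₁₂ hdec
  have hg0 := fun ξ => (hb ξ).1
  have hg := integrable_re_fourier_of_bounds hκ.integrable (by linarith) hb
  obtain ⟨C, hC⟩ := exists_holderENorm_le hd hg.1 hg0 (fun ξ => (hb ξ).2)
    (hc₁.le.trans hc₁₂) hα hs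
  refine ⟨C, fun H _ _ _ _ hH f => ?_⟩
  obtain ⟨F, hF, hfF⟩ := exists_eq_inner_of_kernel_eq_inner
    (fun x : unitCube d => spectralFeatureLp hg hg0 (x : EuclideanSpace ℝ (Fin d)))
    (fun x y => by
      rw [hH x y]
      exact eq_inner_spectralFeatureLp hκ.continuous hκ.integrable hκ.even hg hg0 x y) f
  obtain ⟨h1, h2⟩ := hC F f fun x => by rw [hfF, inner_spectralFeatureLp]
  have h3 : holderENorm α f ≤ C * ‖f‖ₑ := by
    refine h2.trans ?_
    gcongr
    rw [← ofReal_norm, ← ofReal_norm]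
    exact ENNReal.ofReal_le_ofReal hF
  exact ⟨⟨h1, h3.trans_lt (ENNReal.mul_lt_top ENNReal.coe_lt_top enorm_lt_top)⟩, h3⟩

end Embedding

/-! ### An exponential integral for the Bessel function -/

section BesselIntegral

theorem image_mul_exp_univ {c : ℝ} (hc : 0 < c) :
    (fun u => c * Real.exp u) '' Set.univ = Set.Ioi 0 := by
  rw [Set.image_univ]
  ext t
  refine ⟨?_, fun ht => ⟨Real.log (t / c), ?_⟩⟩
  · rintro ⟨u, rfl⟩
    exact mul_pos hc (Real.exp_pos u)
  · change c * Real.exp (Real.log (t / c)) = t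
    rw [Real.exp_log (div_pos ht hc), mul_div_cancel₀ _ hc.ne']

theorem injOn_mul_exp {c : ℝ} (hc : 0 < c) : Set.InjOn (fun u => c * Real.exp u) Set.univ :=
  ((mul_right_injective₀ hc.ne').comp Real.exp_injective).injOn

/-- The substitution `t = c exp u` in an integral over the half-line. -/
theorem integral_Ioi_eq_integral_comp_mul_exp {c : ℝ} (hc : 0 < c) (f : ℝ → ℝ) :
    ∫ t in Set.Ioi 0, f t = ∫ u, c * Real.exp u * f (c * Real.exp u) := by
  rw [← image_mul_exp_univ hc, integral_image_eq_integral_abs_deriv_smul MeasurableSet.univ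
    (fun u _ => ((Real.hasDerivAt_exp u).const_mul c).hasDerivWithinAt) (injOn_mul_exp hc), setIntegral_univ]
  simp only [smul_eq_mul, abs_of_pos (mul_pos hc (Real.exp_pos _))]

theorem integrable_comp_mul_exp_iff {c : ℝ} (hc : 0 < c) (f : ℝ → ℝ) :
    Integrable (fun u => c * Real.exp u * f (c * Real.exp u)) ↔ IntegrableOn f (Set.Ioi 0) := by
  rw [← image_mul_exp_univ hc, integrableOn_image_iff_integrableOn_abs_deriv_smul MeasurableSet.univ
    (fun u _ => ((Real.hasDerivAt_exp u).const_mul c).hasDerivWithinAt) (injOn_mul_exp hc), integrableOn_univ]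
  simp only [smul_eq_mul, abs_of_pos (mul_pos hc (Real.exp_pos _))]

theorem integrableOn_rpow_mul_exp_neg {a : ℝ} (ha : 0 < a) :
    IntegrableOn (fun t : ℝ => t ^ (a - 1) * Real.exp (-t)) (Set.Ioi 0) := by
  simpa only [mul_comm] using Real.GammaIntegral_convergent ha

theorem integrableOn_rpow_mul_exp_neg_mul_exp_neg_div {a : ℝ} (ha : 0 < a) {r : ℝ} (hr : 0 ≤ r) :
    IntegrableOn (fun t : ℝ => t ^ (a - 1) * Real.exp (-t) * Real.exp (-(r / t))) (Set.Ioi 0) := by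
  refine Integrable.mono' (integrableOn_rpow_mul_exp_neg ha)
    (by fun_prop : Measurable _).aestronglyMeasurable ?_
  filter_upwards [ae_restrict_mem measurableSet_Ioi] with t ht
  have ht : 0 < t := ht
  rw [Real.norm_of_nonneg (by positivity)]
  exact mul_le_of_le_one_right (by positivity) (Real.exp_le_one_iff.2 (by
    have : 0 ≤ r / t := by positivity
    linarith))

/-- The Bessel function `K_ν` as an integral of exponentials over the half-line. -/
theorem rpow_mul_besselK {ν z : ℝ} (hν : 0 < ν) (hz : 0 < z) :
    z ^ ν * besselK ν z = 2 ^ (ν - 1) *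
      ∫ t in Set.Ioi 0, t ^ (ν - 1) * Real.exp (-t) * Real.exp (-(z ^ 2 / 4 / t)) := by
  -- The substitution `t = (z / 2) exp u` turns `t + z² / (4t)` into `z cosh u`.
  have hc : 0 < z / 2 := by positivity
  have hpt (u : ℝ) : z / 2 * Real.exp u * ((z / 2 * Real.exp u) ^ (ν - 1) *
      Real.exp (-(z / 2 * Real.exp u)) * Real.exp (-(z ^ 2 / 4 / (z / 2 * Real.exp u)))) =
      (z / 2) ^ ν * (Real.exp (ν * u) * Real.exp (-z * Real.cosh u)) := by
    have h0 : 0 < z / 2 * Real.exp u := mul_pos hc (Real.exp_pos u)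
    have h1 : z ^ 2 / 4 / (z / 2 * Real.exp u) = z / 2 * Real.exp (-u) := by
      rw [Real.exp_neg]
      field_simp
      ring
    have h2 : (z / 2 * Real.exp u) ^ (ν - 1) * (z / 2 * Real.exp u) =
        (z / 2) ^ ν * Real.exp (ν * u) := by
      rw [← Real.rpow_add_one h0.ne', sub_add_cancel, Real.mul_rpow hc.le (Real.exp_pos u).le,
        ← Real.exp_mul, mul_comm u]
    rw [h1, Real.cosh_eq, show -z * ((Real.exp u + Real.exp (-u)) / 2) =
      -(z / 2 * Real.exp u) + -(z / 2 * Real.exp (-u)) by ring, Real.exp_add, ← mul_assoc,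
      ← mul_assoc, mul_comm (z / 2 * Real.exp u), h2]
    ring
  have hi := (integrable_comp_mul_exp_iff hc _).2
    (integrableOn_rpow_mul_exp_neg_mul_exp_neg_div hν (r := z ^ 2 / 4) (by positivity))
  simp only [hpt] at hi
  have hcν : (z / 2) ^ ν ≠ 0 := (Real.rpow_pos_of_pos hc ν).ne'
  have hi' : Integrable fun u => Real.exp (ν * u) * Real.exp (-z * Real.cosh u) := by
    refine (hi.const_mul ((z / 2) ^ ν)⁻¹).congr (.of_forall fun u => ?_)
    simp only
    rw [inv_mul_cancel_left₀ hcν]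
  rw [integral_Ioi_eq_integral_comp_mul_exp hc]
  simp only [hpt]
  -- Folding the line at `0` pairs `exp (νu)` with `exp (-νu)`, which add up to `2 cosh (νu)`.
  rw [integral_const_mul, ← integral_add_compl (measurableSet_Ioi (a := (0 : ℝ))) hi',
    Set.compl_Ioi, ← neg_zero, ← integral_comp_neg_Ioi, neg_zero,
    ← integral_add hi'.integrableOn]
  · have hB : (∫ u in Set.Ioi (0 : ℝ), (Real.exp (ν * u) * Real.exp (-z * Real.cosh u) +
        Real.exp (ν * -u) * Real.exp (-z * Real.cosh (-u)))) = 2 * besselK ν z := by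
      rw [besselK, ← integral_const_mul]
      congr 1
      ext u
      rw [Real.cosh_neg, Real.cosh_eq (ν * u), mul_neg]
      ring
    rw [hB, Real.div_rpow hz.le zero_le_two, Real.rpow_sub_one two_ne_zero]
    have : (2 : ℝ) ^ ν ≠ 0 := (Real.rpow_pos_of_pos two_pos ν).ne'
    field_simp
  · exact hi'.comp_neg.integrableOn

end BesselIntegral

/-! ### Matérn kernels as mixtures of Gaussians -/

section Matern

variable {d : ℕ} {ν l : ℝ}

/-- The Matérn profile is a Gamma mixture of Gaussians. -/
theorem maternProfile_eq_integral (hν : 0 < ν) (hl : 0 < l) (x : EuclideanSpace ℝ (Fin d)) :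
    maternProfile d ν l x = (Real.Gamma ν)⁻¹ * ∫ t in Set.Ioi 0,
      t ^ (ν - 1) * Real.exp (-t) * Real.exp (-(ν / (2 * l ^ 2) * ‖x‖ ^ 2 / t)) := by
  rw [maternProfile]
  split_ifs with hx
  -- At the origin the integral is `Γ(ν)`, matching the prescribed value `1`.
  · rw [hx]
    simp only [norm_zero, ne_eq, OfNat.ofNat_ne_zero, not_false_eq_true, zero_pow, mul_zero,
      zero_div, neg_zero, Real.exp_zero, mul_one]
    have := Real.Gamma_eq_integral hν
    simp only [mul_comm (Real.exp _)] at this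
    rw [← this, inv_mul_cancel₀ (Real.Gamma_pos_of_pos hν).ne']
  · have hx0 : 0 < ‖x‖ := norm_pos_iff.2 hx
    rw [mul_assoc, rpow_mul_besselK hν (by positivity)]
    have h1 : (√(2 * ν) * ‖x‖ / l) ^ 2 / 4 = ν / (2 * l ^ 2) * ‖x‖ ^ 2 := by
      rw [div_pow, mul_pow, Real.sq_sqrt (by positivity)]
      field_simp
      ring
    rw [h1, ← mul_assoc]
    congr 1
    rw [div_mul_eq_mul_div, ← Real.rpow_add two_pos]
    simp
theorem continuous_integral_gamma_gaussian {V : Type*} [NormedAddCommGroup V] (hν : 0 < ν) {b : ℝ}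
    (hb : 0 ≤ b) : Continuous fun x : V => ∫ t in Set.Ioi 0,
      t ^ (ν - 1) * Real.exp (-t) * Real.exp (-(b * ‖x‖ ^ 2 / t)) := by
  refine continuous_of_dominated (fun x => (integrableOn_rpow_mul_exp_neg_mul_exp_neg_div hν
    (by positivity : 0 ≤ b * ‖x‖ ^ 2)).1) (fun x => ?_) (integrableOn_rpow_mul_exp_neg hν)
    (.of_forall fun t => by fun_prop)
  filter_upwards [ae_restrict_mem measurableSet_Ioi] with t ht
  have ht : 0 < t := ht
  rw [Real.norm_of_nonneg (by positivity)]
  exact mul_le_of_le_one_right (by positivity) (Real.exp_le_one_iff.2 (by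
    have : 0 ≤ b * ‖x‖ ^ 2 / t := by positivity
    linarith))

/-! ### Fourier transform of the Gamma mixture -/

section Gaussian

variable {V : Type*} [NormedAddCommGroup V] [InnerProductSpace ℝ V] [FiniteDimensional ℝ V]
  [MeasurableSpace V] [BorelSpace V]

theorem integrable_exp_neg_mul_sq_norm {β : ℝ} (hβ : 0 < β) :
    Integrable fun x : V => Real.exp (-(β * ‖x‖ ^ 2)) := by
  have h := (GaussianFourier.integrable_cexp_neg_mul_sq_norm_add (V := V) (b := (β : ℂ))
    (by simpa using hβ) 0 0).re
  refine h.congr (.of_forall fun x => ?_)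
  simp only [zero_mul, add_zero]
  rw [show -(β : ℂ) * (‖x‖ : ℂ) ^ 2 = ((-(β * ‖x‖ ^ 2) : ℝ) : ℂ) by push_cast; ring,
    ← Complex.ofReal_exp]
  rfl

theorem fourier_ofReal_exp_neg_mul_sq_norm {β : ℝ} (hβ : 0 < β) (ξ : V) :
    𝓕 (fun x : V => ((Real.exp (-(β * ‖x‖ ^ 2)) : ℝ) : ℂ)) ξ =
      (((Real.pi / β) ^ ((Module.finrank ℝ V : ℝ) / 2) *
        Real.exp (-(Real.pi ^ 2 * ‖ξ‖ ^ 2 / β)) : ℝ) : ℂ) := by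
  have h := fourier_gaussian_innerProductSpace (V := V) (b := (β : ℂ)) (by simpa using hβ) ξ
  have h1 : (fun x : V => ((Real.exp (-(β * ‖x‖ ^ 2)) : ℝ) : ℂ)) =
      fun v : V => Complex.exp (-(β : ℂ) * (‖v‖ : ℂ) ^ 2) := by
    ext x
    push_cast
    congr 1
    ring
  rw [h1, h, Complex.ofReal_mul, Complex.ofReal_cpow (by positivity)]
  push_cast
  congr 2
  ring

/-- The transform of a Gaussian of parameter `b / t` contributes `t ^ (n / 2)` and an exponential
linear in `t`. Against the Gamma weight this is again a Gamma integrand, with index `ν + n / 2` and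
rate `1 + r / b`. -/
theorem rpow_mul_exp_neg_mul_rpow_pi_div {b t : ℝ} (hb : 0 < b) (ht : 0 < t) (n : ℝ) (ν r : ℝ) :
    t ^ (ν - 1) * Real.exp (-t) * ((Real.pi / (b / t)) ^ (n / 2) * Real.exp (-(r / (b / t)))) =
      (Real.pi / b) ^ (n / 2) * (t ^ (ν + n / 2 - 1) * Real.exp (-((1 + r / b) * t))) := by
  rw [show Real.pi / (b / t) = Real.pi / b * t by field_simp,
    Real.mul_rpow (by positivity) ht.le, show ν + n / 2 - 1 = (ν - 1) + n / 2 by ring,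
    Real.rpow_add ht, show -((1 + r / b) * t) = -t + -(r / (b / t)) by field_simp; ring,
    Real.exp_add]
  ring

theorem integrable_prod_gamma_gaussian (hν : 0 < ν) {b : ℝ} (hb : 0 < b) :
    Integrable (fun z : V × ℝ =>
      z.2 ^ (ν - 1) * Real.exp (-z.2) * Real.exp (-(b * ‖z.1‖ ^ 2 / z.2)))
      ((volume : Measure V).prod (volume.restrict (Set.Ioi (0 : ℝ)))) := by
  have hrw (t : ℝ) (x : V) : Real.exp (-(b * ‖x‖ ^ 2 / t)) = Real.exp (-(b / t * ‖x‖ ^ 2)) := by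
    congr 1
    ring
  rw [integrable_prod_iff' (by fun_prop : Measurable _).aestronglyMeasurable]
  constructor
  · filter_upwards [ae_restrict_mem measurableSet_Ioi] with t ht
    simp only [hrw]
    exact (integrable_exp_neg_mul_sq_norm (div_pos hb ht)).const_mul _
  · have h := (integrableOn_rpow_mul_exp_neg
      (by positivity : 0 < ν + (Module.finrank ℝ V : ℝ) / 2)).const_mul
      ((Real.pi / b) ^ ((Module.finrank ℝ V : ℝ) / 2))
    refine Integrable.congr h ?_
    filter_upwards [ae_restrict_mem measurableSet_Ioi] with t ht
    have ht : 0 < t := ht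
    -- The integral over `x` is the zero-frequency case `r = 0`.
    have h2 := rpow_mul_exp_neg_mul_rpow_pi_div hb ht (Module.finrank ℝ V) ν 0
    simp only [zero_div, neg_zero, Real.exp_zero, mul_one, add_zero, one_mul] at h2
    rw [← h2, ← GaussianFourier.integral_rexp_neg_mul_sq_norm (div_pos hb ht),
      ← integral_const_mul]
    refine integral_congr_ae (.of_forall fun x => ?_)
    simp only
    rw [Real.norm_of_nonneg (by positivity), hrw, neg_mul]

theorem fourier_integral_gamma_gaussian (hν : 0 < ν) {b : ℝ} (hb : 0 < b) (ξ : V) :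
    𝓕 (fun x : V => ((∫ t in Set.Ioi 0,
        t ^ (ν - 1) * Real.exp (-t) * Real.exp (-(b * ‖x‖ ^ 2 / t)) : ℝ) : ℂ)) ξ =
      (((Real.pi / b) ^ ((Module.finrank ℝ V : ℝ) / 2) *
        Real.Gamma (ν + Module.finrank ℝ V / 2) *
        (1 + Real.pi ^ 2 * ‖ξ‖ ^ 2 / b) ^ (-(ν + Module.finrank ℝ V / 2)) : ℝ) : ℂ) := by
  set n : ℝ := (Module.finrank ℝ V : ℝ) with hn
  have hi := (integrable_prod_gamma_gaussian (V := V) hν hb).ofReal (𝕜 := ℂ)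
  have hi2 : Integrable (fun z : V × ℝ => 𝐞 (-inner ℝ z.1 ξ) •
      ((z.2 ^ (ν - 1) * Real.exp (-z.2) * Real.exp (-(b * ‖z.1‖ ^ 2 / z.2)) : ℝ) : ℂ))
      ((volume : Measure V).prod (volume.restrict (Set.Ioi (0 : ℝ)))) := by
    refine hi.norm.mono' ?_ (.of_forall fun z => by rw [Circle.norm_smul]; rfl)
    refine AEStronglyMeasurable.smul ?_ hi.1
    exact (Continuous.comp continuous_subtype_val (Real.continuous_fourierChar.comp
      (by fun_prop : Continuous fun z : V × ℝ => -(inner ℝ z.1 ξ : ℝ)))).aestronglyMeasurable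
  have hp : 0 < ν + n / 2 := by positivity
  have hr : 0 < 1 + Real.pi ^ 2 * ‖ξ‖ ^ 2 / b := by positivity
  calc 𝓕 (fun x : V => ((∫ t in Set.Ioi 0,
        t ^ (ν - 1) * Real.exp (-t) * Real.exp (-(b * ‖x‖ ^ 2 / t)) : ℝ) : ℂ)) ξ
      = ∫ x : V, ∫ t in Set.Ioi (0 : ℝ), 𝐞 (-inner ℝ x ξ) •
          ((t ^ (ν - 1) * Real.exp (-t) * Real.exp (-(b * ‖x‖ ^ 2 / t)) : ℝ) : ℂ) := by
        rw [Real.fourier_eq]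
        refine integral_congr_ae (.of_forall fun x => ?_)
        simp only [Circle.smul_def]
        rw [integral_smul, integral_complex_ofReal]
    _ = ∫ t in Set.Ioi (0 : ℝ), ∫ x : V, 𝐞 (-inner ℝ x ξ) •
          ((t ^ (ν - 1) * Real.exp (-t) * Real.exp (-(b * ‖x‖ ^ 2 / t)) : ℝ) : ℂ) :=
        integral_integral_swap hi2
    _ = ∫ t in Set.Ioi (0 : ℝ), (((Real.pi / b) ^ (n / 2) * (t ^ (ν + n / 2 - 1) *
          Real.exp (-((1 + Real.pi ^ 2 * ‖ξ‖ ^ 2 / b) * t))) : ℝ) : ℂ) := by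
        refine setIntegral_congr_fun measurableSet_Ioi fun t ht => ?_
        have ht : 0 < t := ht
        rw [← rpow_mul_exp_neg_mul_rpow_pi_div hb ht, Complex.ofReal_mul, hn,
          ← fourier_ofReal_exp_neg_mul_sq_norm (div_pos hb ht), Real.fourier_eq,
          ← integral_const_mul]
        refine integral_congr_ae (.of_forall fun x => ?_)
        simp only [Circle.smul_def, smul_eq_mul]
        rw [Complex.ofReal_mul, show b * ‖x‖ ^ 2 / t = b / t * ‖x‖ ^ 2 by ring]
        ring
    _ = _ := by
        rw [integral_complex_ofReal, integral_const_mul, Real.integral_rpow_mul_exp_neg_mul_Ioi hp hr,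
          one_div, Real.inv_rpow hr.le, ← Real.rpow_neg hr.le]
        congr 1
        ring

end Gaussian

theorem integrable_maternProfile (hν : 0 < ν) (hl : 0 < l) : Integrable (maternProfile d ν l) := by
  rw [funext (maternProfile_eq_integral hν hl)]
  exact (integrable_prod_gamma_gaussian hν (by positivity)).integral_prod_left.const_mul _

theorem continuous_maternProfile (hν : 0 < ν) (hl : 0 < l) : Continuous (maternProfile d ν l) := by
  rw [funext (maternProfile_eq_integral hν hl)]
  exact (continuous_integral_gamma_gaussian hν (by positivity)).const_mul _

theorem maternProfile_neg (x : EuclideanSpace ℝ (Fin d)) :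
    maternProfile d ν l (-x) = maternProfile d ν l x := by
  simp [maternProfile]

/-- With `b = ν / (2 l²)` and frequency `ω / 2π`, the quantity `π² ‖ω / 2π‖² / b` is `‖ω‖² / (4b) =
‖ω‖² / (2ν / l²)`. -/
theorem angularFourier_maternProfile (hν : 0 < ν) (hl : 0 < l) (ω : EuclideanSpace ℝ (Fin d)) :
    (angularFourier (maternProfile d ν l) ω).re =
      (Real.Gamma ν)⁻¹ * ((Real.pi / (ν / (2 * l ^ 2))) ^ ((d : ℝ) / 2) *
        Real.Gamma (ν + d / 2)) * (1 + ‖ω‖ ^ 2 / (2 * ν / l ^ 2)) ^ (-(ν + (d : ℝ) / 2)) := by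
  have hb : 0 < ν / (2 * l ^ 2) := by positivity
  have h := fourier_integral_gamma_gaussian hν hb ((2 * Real.pi)⁻¹ • ω)
  have hF : (fun x => (maternProfile d ν l x : ℂ)) = fun x => ((Real.Gamma ν)⁻¹ : ℂ) •
      ((∫ t in Set.Ioi 0, t ^ (ν - 1) * Real.exp (-t) *
        Real.exp (-(ν / (2 * l ^ 2) * ‖x‖ ^ 2 / t)) : ℝ) : ℂ) := by
    ext x
    rw [maternProfile_eq_integral hν hl, smul_eq_mul]
    push_cast
    rfl
  have hsm : angularFourier (maternProfile d ν l) ω = ((Real.Gamma ν)⁻¹ : ℂ) *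
      𝓕 (fun x : EuclideanSpace ℝ (Fin d) => ((∫ t in Set.Ioi 0, t ^ (ν - 1) * Real.exp (-t) *
        Real.exp (-(ν / (2 * l ^ 2) * ‖x‖ ^ 2 / t)) : ℝ) : ℂ)) ((2 * Real.pi)⁻¹ • ω) := by
    rw [angularFourier, hF, Real.fourier_eq, Real.fourier_eq, ← integral_const_mul]
    refine integral_congr_ae (.of_forall fun x => ?_)
    simp only [Circle.smul_def, smul_eq_mul]
    ring
  rw [hsm, h, finrank_euclideanSpace_fin, ← Complex.ofReal_inv, ← Complex.ofReal_mul,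
    Complex.ofReal_re, ← mul_assoc]
  congr 3
  rw [norm_smul, Real.norm_of_nonneg (by positivity)]
  have := Real.pi_ne_zero
  field_simp

/-- The decay constants come from `(1 + r) / max 1 a ≤ 1 + r / a ≤ (1 + r) / min 1 a` with `r =
‖ω‖²`, raised to the negative power `-p`. These bounds make the spectral density nonnegative and
integrable, and the feature map then gives positive definiteness. -/
theorem isKernelWithFourierDecay_maternProfile (hν : 0 < ν) (hl : 0 < l) :
    IsKernelWithFourierDecay (maternProfile d ν l) (ν + (d : ℝ) / 2) := by
  set a : ℝ := 2 * ν / l ^ 2 with ha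
  have ha0 : 0 < a := by positivity
  set p : ℝ := ν + (d : ℝ) / 2 with hp
  have hp0 : 0 < p := by positivity
  set K : ℝ := (Real.Gamma ν)⁻¹ * ((Real.pi / (ν / (2 * l ^ 2))) ^ ((d : ℝ) / 2) *
    Real.Gamma (ν + d / 2)) with hK
  have hK0 : 0 < K := by
    have := Real.Gamma_pos_of_pos hν
    have := Real.Gamma_pos_of_pos hp0
    positivity
  have hmin : 0 < min 1 a := lt_min one_pos ha0
  have hmax : 0 < max 1 a := lt_max_of_lt_left one_pos
  have hc : K * min 1 a ^ p ≤ K * max 1 a ^ p :=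
    mul_le_mul_of_nonneg_left (Real.rpow_le_rpow hmin.le min_le_max hp0.le) hK0.le
  have hscale {m : ℝ} (hm : 0 < m) (r : ℝ) (hr : 0 < r) : m ^ p * r ^ (-p) = (r / m) ^ (-p) := by
    rw [Real.div_rpow hr.le hm.le, Real.rpow_neg hm.le p, div_inv_eq_mul, mul_comm]
  have hdec (ω : EuclideanSpace ℝ (Fin d)) :
      K * min 1 a ^ p * (1 + ‖ω‖ ^ 2) ^ (-p) ≤ (angularFourier (maternProfile d ν l) ω).re ∧
      (angularFourier (maternProfile d ν l) ω).re ≤ K * max 1 a ^ p * (1 + ‖ω‖ ^ 2) ^ (-p) := by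
    have h1 : 0 < 1 + ‖ω‖ ^ 2 := by positivity
    have hsq : 0 ≤ ‖ω‖ ^ 2 := by positivity
    rw [angularFourier_maternProfile hν hl, ← hK, mul_assoc K (min 1 a ^ p),
      mul_assoc K (max 1 a ^ p), hscale hmin _ h1,
      hscale hmax _ h1]
    constructor
    · refine mul_le_mul_of_nonneg_left
        (Real.rpow_le_rpow_of_nonpos (by positivity) ?_ (by linarith)) hK0.le
      rw [add_div]
      refine add_le_add ((one_le_div hmin).2 (min_le_left _ _)) ?_
      exact div_le_div_of_nonneg_left hsq hmin (min_le_right _ _)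
    · refine mul_le_mul_of_nonneg_left
        (Real.rpow_le_rpow_of_nonpos (by positivity) ?_ (by linarith)) hK0.le
      rw [add_div]
      refine add_le_add ((div_le_one hmax).2 (le_max_left _ _)) ?_
      exact div_le_div_of_nonneg_left hsq ha0 (le_max_right _ _)
  have hc₁ : 0 < K * min 1 a ^ p := by positivity
  have hb := re_fourier_bounds_of_decay hp0.le hc₁ hc hdec
  have hi : Integrable (maternProfile d ν l) := integrable_maternProfile hν hl
  refine ⟨continuous_maternProfile hν hl, hi, ?_, _, _, hc₁, hc, hdec⟩
  exact posSemidef_of_eq_inner (spectralFeatureLp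
    (integrable_re_fourier_of_bounds hi (by linarith) hb) fun ξ => (hb ξ).1) fun x y =>
    eq_inner_spectralFeatureLp (continuous_maternProfile hν hl) hi maternProfile_neg _ _ x y

end Matern

theorem mainTheorem7 (d : ℕ) (hd : 0 < d) :
    (∀ (κ : EuclideanSpace ℝ (Fin d) → ℝ) (s : ℕ), (d : ℝ) / 2 < s →
      IsKernelWithFourierDecay κ s → RKHSEmbedsIntoHolder.{u} κ (s - (d : ℝ) / 2)) ∧
    (∀ ν l : ℝ, 0 < ν → 0 < l →
      IsKernelWithFourierDecay (maternProfile d ν l) (ν + (d : ℝ) / 2) ∧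
        RKHSEmbedsIntoHolder.{u} (maternProfile d ν l) ν) := by
  refine ⟨fun κ s hs hκ => ?_, fun ν l hν hl => ?_⟩
  · exact rkhsEmbedsIntoHolder_of_decay hd (sub_pos.2 hs) (by ring) hκ
  · have h := isKernelWithFourierDecay_maternProfile (d := d) hν hl
    exact ⟨h, rkhsEmbedsIntoHolder_of_decay hd hν rfl h⟩
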